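/- A range set is a set $R\subseteq[0,\infty)$ with $0\in R$; it is called characteristic if for every $t\in(0,\infty)$ there exists $r\in R\setminus\{0\}$ with $r\le t$. An $R$-ultrametric space is a metric space $(X,d)$ with $d(x,y)\in R$ and $d(x,y)\le \max\{d(x,z),d(z,y)\}$ for all $x,y,z\in X$. An $R$-Urysohn universal ultrametric space is a separable complete $R$-ultrametric space $(X,d)$ such that for all finite (possibly empty) $R$-ultrametric spaces $(A,a)$ and $(B,b)$ and all isometric embeddings $\phi\colon A\to B$ and $\psi\colon A\to X$ there exists an isometric embedding $\theta\colon B\to X$ with $\theta\circ\phi=\psi$. Let $R$ be a countable characteristic range set. Then an $R$-Urysohn universal ultrametric space exists, and every $R$-Urysohn universal ultrametric space is homeomorphic to the space $\mathbb{R}\setminus\mathbb{Q}$ of irrational numbers, with the topology induced from $\mathbb{R}$. -/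

import Mathlib

universe u

/-- A range set: a subset of `[0, ∞)` containing `0`. -/
structure IsRangeSet (R : Set ℝ) : Prop where
  nonneg : ∀ r ∈ R, 0 ≤ r
  zero_mem : (0 : ℝ) ∈ R

/-- `R` is characteristic: it has nonzero elements below every positive real number. -/
def IsCharacteristic (R : Set ℝ) : Prop :=
  ∀ t : ℝ, 0 < t → ∃ r ∈ R \ {0}, r ≤ t

/-- `X` is an `R`-ultrametric space: its metric is an ultrametric with values in `R`. -/
structure IsRUltrametric (R : Set ℝ) (X : Type u) [MetricSpace X] : Prop where
  ultrametric : IsUltrametricDist X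
  dist_mem : ∀ x y : X, dist x y ∈ R

/-- The class `N(R)` of all finite `R`-ultrametric spaces. The empty space belongs to it. Carriers
are taken in `Type`: every finite metric space is isometric to one carried by some `Fin n`. -/
def FiniteRUltrametric (R : Set ℝ) (A : Type) [MetricSpace A] : Prop :=
  Finite A ∧ IsRUltrametric R A

/-- `X` is `C`-injective, for a class `C` of metric spaces: for all `A`, `B` in `C` and isometric
embeddings `φ : A → B`, `ψ : A → X` there is an isometric embedding `θ : B → X`
with `θ ∘ φ = ψ`. -/
def IsMetricInjective (C : ∀ (A : Type) [MetricSpace A], Prop) (X : Type u) [MetricSpace X] :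
    Prop :=
  ∀ (A B : Type) [MetricSpace A] [MetricSpace B], C A → C B →
    ∀ (φ : A → B) (ψ : A → X), Isometry φ → Isometry ψ →
      ∃ θ : B → X, Isometry θ ∧ θ ∘ φ = ψ

/-- `X` is an `R`-Urysohn universal ultrametric space: a separable complete `N(R)`-injective
`R`-ultrametric space. -/
structure IsUrysohnUltrametric (R : Set ℝ) (X : Type u) [MetricSpace X] : Prop where
  separable : TopologicalSpace.SeparableSpace X
  complete : CompleteSpace X
  rUltrametric : IsRUltrametric R X
  injective : IsMetricInjective (FiniteRUltrametric R) X

/-! Uniqueness is topological: both `X` and the irrationals are nonempty, Polish, have clopen bases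
and no nonempty compact clopen subset, so the Alexandrov–Urysohn theorem identifies each with `ℕ →
ℕ`. In `X`, balls are clopen; injectivity puts arbitrarily large finite equilateral sets of side `r`
around any point, for arbitrarily small `r ∈ R`, so no nonempty open set is totally bounded. For
existence, `FinitaryFun` measures two functions by the largest argument where they differ. An
infinite value set leaves a fresh value at each radius, which gives one-point extensions and, by
induction, injectivity. -/

open Set Filter Topology

/-! ### The Alexandrov–Urysohn characterization of Baire space -/

/-- Any nonempty noncompact clopen subset of a complete separable metric space with a basis of
clopen sets is partitioned by infinitely many small nonempty clopen sets. -/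
theorem IsClopen.exists_infinite_partition {Y : Type*} [MetricSpace Y] [CompleteSpace Y]
    [SecondCountableTopology Y]
    (hbasis : ∀ x : Y, ∀ V ∈ 𝓝 x, ∃ C, IsClopen C ∧ x ∈ C ∧ C ⊆ V)
    {U : Set Y} (hU : IsClopen U) (hne : U.Nonempty) (hcomp : ¬ IsCompact U)
    {ε : ℝ} (hε : 0 < ε) :
    ∃ D : ℕ → Set Y, (∀ n, IsClopen (D n) ∧ (D n).Nonempty) ∧
      Pairwise (fun m n => Disjoint (D m) (D n)) ∧ ⋃ n, D n = U ∧
      ∀ n, ∀ x ∈ D n, ∀ y ∈ D n, dist x y ≤ ε := by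
  obtain ⟨δ, hδ, hfin⟩ : ∃ δ > 0, ∀ t : Set Y, t.Finite → ¬ U ⊆ ⋃ y ∈ t, Metric.ball y δ := by
    by_contra! h
    exact hcomp (isCompact_iff_totallyBounded_isComplete.2
      ⟨Metric.totallyBounded_iff.2 h, hU.isClosed.isComplete⟩)
  -- `ε / 2` bounds the diameters; `δ` forces infinitely many nonempty pieces, since finitely many
  -- would give a finite `δ`-cover of `U`.
  have hη : 0 < min (ε / 2) δ := lt_min (half_pos hε) hδ
  choose C hC hxC hCb using fun x : Y => hbasis x _ (Metric.ball_mem_nhds x hη)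
  obtain ⟨t, htc, htU⟩ := TopologicalSpace.countable_cover_nhds
    fun x => (hC x).isOpen.mem_nhds (hxC x)
  have htne : t.Nonempty := by
    obtain ⟨x, -⟩ := hne
    have hx : x ∈ ⋃ y ∈ t, C y := htU ▸ mem_univ x
    obtain ⟨y, hy, -⟩ := mem_iUnion₂.1 hx
    exact ⟨y, hy⟩
  obtain ⟨e, rfl⟩ := htc.exists_eq_range htne
  have hcover : ⋃ n, disjointed (fun n => C (e n)) n = univ := by
    rw [iUnion_disjointed]; simpa using htU
  have hclopen (n : ℕ) : IsClopen (disjointed (fun n => C (e n)) n) :=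
    disjointedRec (fun s i hs => hs.diff (hC (e i))) (hC (e n))
  set D : ℕ → Set Y := fun n => U ∩ disjointed (fun n => C (e n)) n with hD
  have hDb (n : ℕ) : D n ⊆ Metric.ball (e n) (min (ε / 2) δ) := fun x hx =>
    hCb _ (disjointed_subset (fun n => C (e n)) n hx.2)
  have hDU : ⋃ n, D n = U := by rw [← inter_iUnion, hcover, inter_univ]
  have hinf : {n | (D n).Nonempty}.Infinite := by
    intro hI
    refine hfin _ (hI.image e) fun x hx => ?_
    rw [← hDU] at hx
    obtain ⟨n, hn⟩ := mem_iUnion.1 hx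
    exact mem_biUnion (mem_image_of_mem e ⟨x, hn⟩)
      (Metric.ball_subset_ball (min_le_right _ _) (hDb n hn))
  -- Enumerating the nonempty pieces discards the empty ones.
  have hinj := Nat.nth_injective hinf
  refine ⟨fun k => D (Nat.nth (fun n => (D n).Nonempty) k),
    fun k => ⟨hU.inter (hclopen _), Nat.nth_mem_of_infinite hinf k⟩, fun i j hij => ?_, ?_, ?_⟩
  · exact (disjoint_disjointed _ (hinj.ne hij)).mono inter_subset_right inter_subset_right
  · rw [← hDU]
    refine Subset.antisymm (iUnion_subset fun k => subset_iUnion D _) (iUnion_subset fun n x hx => ?_)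
    have hn : n ∈ range (Nat.nth fun n => (D n).Nonempty) := by
      rw [Nat.range_nth_of_infinite hinf]; exact ⟨x, hx⟩
    obtain ⟨k, rfl⟩ := hn
    exact mem_iUnion.2 ⟨k, hx⟩
  · intro k x hx y hy
    have h1 := Metric.mem_ball.1 (hDb _ hx)
    have h2 := Metric.mem_ball.1 (hDb _ hy)
    have h3 := dist_triangle_right x y (e (Nat.nth (fun n => (D n).Nonempty) k))
    have h4 := min_le_left (ε / 2) δ
    linarith

/-- A scheme of nonempty clopen sets with vanishing diameter, in which every set is partitioned by
its children, induces a homeomorphism from the space of branches. -/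
theorem nonempty_homeomorph_of_scheme {Y β : Type*} [MetricSpace Y] [CompleteSpace Y]
    [TopologicalSpace β] [DiscreteTopology β] (A : List β → Set Y) (hnil : A [] = univ)
    (hclopen : ∀ l, IsClopen (A l)) (hne : ∀ l, (A l).Nonempty)
    (hunion : ∀ l, ⋃ a, A (a :: l) = A l) (hdisj : CantorScheme.Disjoint A)
    (hdiam : CantorScheme.VanishingDiam A) : Nonempty (Y ≃ₜ (ℕ → β)) := by
  have hanti : CantorScheme.Antitone A := fun l a => by
    rw [← hunion l]; exact subset_iUnion (fun a => A (a :: l)) a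
  have hdom := (hanti.closureAntitone fun l => (hclopen l).isClosed).map_of_vanishingDiam
    hdiam hne
  have hmemdom (x : ℕ → β) : x ∈ (CantorScheme.inducedMap A).1 := hdom ▸ mem_univ x
  let f : (ℕ → β) → Y := fun x => (CantorScheme.inducedMap A).2 ⟨x, hmemdom x⟩
  have hfmem (x : ℕ → β) (n : ℕ) : f x ∈ A (PiNat.res x n) :=
    CantorScheme.map_mem (⟨x, hmemdom x⟩ : (CantorScheme.inducedMap A).1) n
  have hfcont : Continuous f := hdiam.map_continuous.comp (by fun_prop)
  have hfinj : Function.Injective f := fun x y h => congrArg Subtype.val (hdisj.map_injective h)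
  -- A prefix whose set contains `y` extends to a branch mapped to `y`: keep choosing a child
  -- containing `y`. With `n = 0` this gives surjectivity, with general `n` openness.
  have hbranch (y : Y) (z : ℕ → β) (n : ℕ) (hy : y ∈ A (PiNat.res z n)) :
      ∃ x, PiNat.res x n = PiNat.res z n ∧ f x = y := by
    have hstep (l : List β) (hl : y ∈ A l) : ∃ a, y ∈ A (a :: l) := by
      rw [← hunion l] at hl; exact mem_iUnion.1 hl
    choose g hg using hstep
    let L : ℕ → {l : List β // y ∈ A l} := fun k =>
      Nat.rec ⟨_, hy⟩ (fun _ l => ⟨g l.1 l.2 :: l.1, hg l.1 l.2⟩) k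
    let x : ℕ → β := fun k => if k < n then z k else g (L (k - n)).1 (L (k - n)).2
    have hx0 : PiNat.res x n = PiNat.res z n :=
      PiNat.res_eq_res.2 fun k hk => if_pos hk
    have hxL (k : ℕ) : PiNat.res x (n + k) = (L k).1 := by
      induction k with
      | zero => exact hx0
      | succ k ih =>
        rw [← add_assoc, PiNat.res_succ, ih]
        have : x (n + k) = g (L k).1 (L k).2 := by simp [x]
        rw [this]
    refine ⟨x, hx0, eq_of_forall_dist_le fun ε hε => ?_⟩
    obtain ⟨m, hm⟩ := hdiam.dist_lt ε hε x
    have hle : A (PiNat.res x (n + m)) ⊆ A (PiNat.res x m) :=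
      antitone_nat_of_succ_le (f := fun n => A (PiNat.res x n)) (fun k => hanti _ _)
        (Nat.le_add_left m n)
    exact (hm _ (hfmem x m) _ (hle (hxL m ▸ (L m).2))).le
  have hβ : Nonempty β := by
    obtain ⟨y, hy⟩ := hne []
    rw [← hunion] at hy
    exact ⟨(mem_iUnion.1 hy).choose⟩
  have hfsurj : Function.Surjective f := fun y =>
    (hbranch y (fun _ => Classical.arbitrary β) 0 (by simp [hnil])).imp fun _ h => h.2
  have hfopen : IsOpenMap f := by
    refine IsOpenMap.of_nhds_le fun x => ?_
    intro V hV
    obtain ⟨W, hWV, hWo, hxW⟩ := mem_nhds_iff.1 (mem_map.1 hV)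
    obtain ⟨s, ⟨z, n, rfl⟩, hxs, hsW⟩ :=
      (PiNat.isTopologicalBasis_cylinders fun _ : ℕ => β).exists_subset_of_mem_open hxW hWo
    rw [PiNat.cylinder_eq_res] at hxs hsW
    refine mem_of_superset ((hclopen _).isOpen.mem_nhds (hfmem x n)) fun y hy => ?_
    obtain ⟨x', hx', rfl⟩ := hbranch y x n hy
    exact hWV (hsW (hx'.trans hxs))
  exact ⟨(Equiv.toHomeomorphOfContinuousOpen (Equiv.ofBijective f ⟨hfinj, hfsurj⟩)
    hfcont hfopen).symm⟩

/-- The Alexandrov–Urysohn theorem: a nonempty Polish space with a basis of clopen sets and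
without nonempty compact clopen subsets is homeomorphic to the Baire space. -/
theorem nonempty_homeomorph_nat_nat (Y : Type*) [TopologicalSpace Y] [PolishSpace Y] [Nonempty Y]
    (hbasis : ∀ x : Y, ∀ V ∈ 𝓝 x, ∃ C, IsClopen C ∧ x ∈ C ∧ C ⊆ V)
    (hcomp : ∀ U : Set Y, IsClopen U → U.Nonempty → ¬ IsCompact U) :
    Nonempty (Y ≃ₜ (ℕ → ℕ)) := by
  let := TopologicalSpace.upgradeIsCompletelyMetrizable Y
  choose D hD hdisj hunion hdist using
    fun (U : {U : Set Y // IsClopen U ∧ U.Nonempty}) (n : ℕ) =>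
      U.2.1.exists_infinite_partition hbasis U.2.2 (hcomp _ U.2.1 U.2.2)
        (pow_pos (half_pos (zero_lt_one' ℝ)) n)
  let B : List ℕ → {U : Set Y // IsClopen U ∧ U.Nonempty} := fun l =>
    List.rec ⟨univ, isClopen_univ, univ_nonempty⟩
      (fun a l U => ⟨D U l.length a, hD U l.length a⟩) l
  refine nonempty_homeomorph_of_scheme (fun l => (B l).1) rfl (fun l => (B l).2.1)
    (fun l => (B l).2.2) (fun l => hunion (B l) l.length)
    (fun l => hdisj (B l) l.length) fun x => ?_
  -- Level `n + 1` has diameter at most `(1 / 2) ^ n`; level `0` is the whole space, with no bound.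
  rw [← tendsto_add_atTop_iff_nat 1]
  have hlim : Tendsto (fun n : ℕ => ENNReal.ofReal ((1 / 2 : ℝ) ^ n)) atTop (𝓝 0) := by
    rw [← ENNReal.ofReal_zero]
    exact ENNReal.tendsto_ofReal
      (tendsto_pow_atTop_nhds_zero_of_lt_one (by norm_num) (by norm_num))
  refine tendsto_of_tendsto_of_tendsto_of_le_of_le tendsto_const_nhds hlim
    (fun _ => zero_le) fun n => Metric.ediam_le fun y hy z hz => ?_
  rw [edist_dist]
  refine ENNReal.ofReal_le_ofReal ?_
  have := hdist (B (PiNat.res x n)) (PiNat.res x n).length (x n) y hy z hz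
  rwa [PiNat.res_length] at this

/-! ### The irrationals -/

/-- Adjoining all the reciprocals `(x - q)⁻¹` as coordinates embeds the irrationals onto a closed
subset of a Polish product. -/
instance polishSpace_irrational : PolishSpace {x : ℝ // Irrational x} := by
  have hne (x : {x : ℝ // Irrational x}) (q : ℚ) : x.1 - q ≠ 0 := sub_ne_zero.2 (x.2.ne_rat q)
  let f : {x : ℝ // Irrational x} → ℝ × (ℚ → ℝ) := fun x => (x.1, fun q => (x.1 - q)⁻¹)
  have hf : Continuous f := continuous_subtype_val.prodMk (continuous_pi fun q =>
    (continuous_subtype_val.sub continuous_const).inv₀ fun x => hne x q)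
  have hrange : range f = {p : ℝ × (ℚ → ℝ) | ∀ q : ℚ, (p.2 q : ℝ) * (p.1 - (q : ℝ)) = 1} := by
    ext p
    constructor
    · rintro ⟨x, rfl⟩ q
      exact inv_mul_cancel₀ (hne x q)
    · intro hp
      refine ⟨⟨p.1, ?_⟩, Prod.ext rfl (funext fun q => (eq_inv_of_mul_eq_one_left (hp q)).symm)⟩
      rintro ⟨q, hq⟩
      have := hp q
      simp [← hq] at this
  refine Topology.IsClosedEmbedding.polishSpace (f := f) ⟨?_, ?_⟩
  · exact Topology.IsEmbedding.of_comp hf continuous_fst Topology.IsEmbedding.subtypeVal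
  · rw [hrange, ofPred_forall]
    exact isClosed_iInter fun q => isClosed_eq (by fun_prop) continuous_const

theorem irrational_exists_isClopen_subset (x : {x : ℝ // Irrational x}) {V : Set _}
    (hV : V ∈ 𝓝 x) : ∃ C, IsClopen C ∧ x ∈ C ∧ C ⊆ V := by
  obtain ⟨W, hW, hWV⟩ := mem_nhds_subtype _ _ _ |>.1 hV
  obtain ⟨ε, hε, hball⟩ := Metric.mem_nhds_iff.1 hW
  obtain ⟨a, ha, hax⟩ := exists_rat_btwn (sub_lt_self x.1 hε)
  obtain ⟨b, hxb, hb⟩ := exists_rat_btwn (lt_add_of_pos_right x.1 hε)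
  refine ⟨Subtype.val ⁻¹' Ioo (a : ℝ) b, ⟨?_, isOpen_Ioo.preimage continuous_subtype_val⟩,
    ⟨hax, hxb⟩, fun y hy => hWV (hball ?_)⟩
  · have : (Subtype.val ⁻¹' Ioo (a : ℝ) b : Set {x : ℝ // Irrational x}) =
        Subtype.val ⁻¹' Icc (a : ℝ) b := by
      ext y
      exact and_congr (y.2.ne_rat a).symm.le_iff_lt.symm (y.2.ne_rat b).le_iff_lt.symm
    rw [this]
    exact isClosed_Icc.preimage continuous_subtype_val
  · rw [Real.ball_eq_Ioo]
    exact ⟨ha.trans hy.1, hy.2.trans hb⟩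

/-- A compact set has closed image in `ℝ`, but the irrationals of an open `W` accumulate at every
rational in `W`. -/
theorem irrational_not_isCompact {U : Set {x : ℝ // Irrational x}} (hU : IsOpen U)
    (hne : U.Nonempty) : ¬ IsCompact U := by
  intro hc
  obtain ⟨W, hW, rfl⟩ := isOpen_induced_iff.1 hU
  obtain ⟨x, hx⟩ := hne
  obtain ⟨q, hqW⟩ := Rat.isDenseEmbedding_coe_real.dense.exists_mem_open hW ⟨x.1, hx⟩
  have hcl : (q : ℝ) ∈ closure (W ∩ {x | Irrational x}) :=
    hW.inter_closure ⟨hqW, dense_irrational q⟩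
  rw [inter_comm, ← Subtype.image_preimage_val] at hcl
  replace hcl := (hc.image continuous_subtype_val).isClosed.closure_subset hcl
  obtain ⟨y, -, hy⟩ := hcl
  exact y.2.ne_rat q hy

theorem nonempty_homeomorph_irrational_nat_nat :
    Nonempty ({x : ℝ // Irrational x} ≃ₜ (ℕ → ℕ)) :=
  haveI : Nonempty {x : ℝ // Irrational x} := ⟨⟨_, irrational_sqrt_two⟩⟩
  nonempty_homeomorph_nat_nat _ (fun x _ hV => irrational_exists_isClopen_subset x hV)
    fun _ hU hne => irrational_not_isCompact hU.isOpen hne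
-- The function-space model
/-- Functions `f : ℝ → N` supported in `R ∩ (0, ∞)`, with only finitely many nonzero values on
every `[t, ∞)`, `t > 0`. -/
def FinitaryFun (R : Set ℝ) (N : Type u) [Zero N] : Type u :=
  {f : ℝ → N // (∀ r, f r ≠ 0 → r ∈ R ∧ 0 < r) ∧ ∀ t > 0, {r | t ≤ r ∧ f r ≠ 0}.Finite}

namespace FinitaryFun

variable {R : Set ℝ} {N : Type u} [Zero N]

instance : Nonempty (FinitaryFun R N) := ⟨⟨fun _ => 0, by simp, by simp⟩⟩

theorem mem_of_ne (f g : FinitaryFun R N) {r : ℝ} (h : f.1 r ≠ g.1 r) : r ∈ R ∧ 0 < r := by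
  by_cases hf : f.1 r = 0
  · exact g.2.1 r fun hg => h (hf.trans hg.symm)
  · exact f.2.1 r hf

theorem exists_isGreatest {f g : FinitaryFun R N} (h : f ≠ g) :
    ∃ r, IsGreatest {r | f.1 r ≠ g.1 r} r := by
  obtain ⟨t, ht⟩ : ∃ t, f.1 t ≠ g.1 t := by
    by_contra! h'
    exact h (Subtype.ext (funext h'))
  have htpos := (f.mem_of_ne g ht).2
  have hfin : {r | t ≤ r ∧ f.1 r ≠ g.1 r}.Finite := by
    refine ((f.2.2 t htpos).union (g.2.2 t htpos)).subset fun r hr => ?_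
    by_cases hf : f.1 r = 0
    · exact Or.inr ⟨hr.1, fun hg => hr.2 (hf.trans hg.symm)⟩
    · exact Or.inl ⟨hr.1, hf⟩
  obtain ⟨m, hm, hmax⟩ := exists_max_image _ id hfin ⟨t, le_rfl, ht⟩
  refine ⟨m, hm.2, fun r hr => ?_⟩
  rcases le_total t r with h | h
  · exact hmax r ⟨h, hr⟩
  · exact h.trans hm.1

noncomputable instance : Dist (FinitaryFun R N) := ⟨fun f g => sSup {r | f.1 r ≠ g.1 r}⟩

theorem dist_of_isGreatest {f g : FinitaryFun R N} {r : ℝ}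
    (h : IsGreatest {r | f.1 r ≠ g.1 r} r) : dist f g = r :=
  h.csSup_eq

theorem dist_self' (f : FinitaryFun R N) : dist f f = 0 := by
  change sSup {r | f.1 r ≠ f.1 r} = 0
  simp

theorem dist_le_iff {f g : FinitaryFun R N} {t : ℝ} (ht : 0 ≤ t) :
    dist f g ≤ t ↔ ∀ r, t < r → f.1 r = g.1 r := by
  rcases eq_or_ne f g with rfl | h
  · simpa [dist_self'] using ht
  · obtain ⟨m, hm⟩ := exists_isGreatest h
    rw [dist_of_isGreatest hm]
    refine ⟨fun hmt r hr => ?_, fun hr => ?_⟩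
    · by_contra hne
      exact absurd (hm.2 hne) (not_le.2 (hmt.trans_lt hr))
    · by_contra! hlt
      exact hm.1 (hr m hlt)

theorem dist_nonneg' (f g : FinitaryFun R N) : 0 ≤ dist f g := by
  rcases eq_or_ne f g with rfl | h
  · exact (dist_self' f).ge
  · obtain ⟨m, hm⟩ := exists_isGreatest h
    rw [dist_of_isGreatest hm]
    exact (f.mem_of_ne g hm.1).2.le

theorem dist_le_max (f g h : FinitaryFun R N) : dist f h ≤ max (dist f g) (dist g h) := by
  refine (dist_le_iff (le_max_of_le_left (dist_nonneg' f g))).2 fun r hr => ?_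
  exact ((dist_le_iff (dist_nonneg' f g)).1 le_rfl r ((le_max_left _ _).trans_lt hr)).trans
    ((dist_le_iff (dist_nonneg' g h)).1 le_rfl r ((le_max_right _ _).trans_lt hr))

noncomputable instance : MetricSpace (FinitaryFun R N) where
  dist_self := dist_self'
  dist_comm f g := congrArg sSup (by simp only [ne_comm])
  dist_triangle f g h := (dist_le_max f g h).trans
    (max_le_add_of_nonneg (dist_nonneg' f g) (dist_nonneg' g h))
  eq_of_dist_eq_zero {f g} h := by
    by_contra hne
    obtain ⟨m, hm⟩ := exists_isGreatest hne
    rw [dist_of_isGreatest hm] at h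
    exact (f.mem_of_ne g hm.1).2.ne' h

instance : IsUltrametricDist (FinitaryFun R N) := ⟨dist_le_max⟩

theorem dist_mem (h0 : (0 : ℝ) ∈ R) (f g : FinitaryFun R N) : dist f g ∈ R := by
  rcases eq_or_ne f g with rfl | h
  · rwa [dist_self]
  · obtain ⟨m, hm⟩ := exists_isGreatest h
    rw [dist_of_isGreatest hm]
    exact (f.mem_of_ne g hm.1).1

theorem eq_of_dist_lt {f g : FinitaryFun R N} {r : ℝ} (h : dist f g < r) : f.1 r = g.1 r :=
  (dist_le_iff dist_nonneg).1 le_rfl r h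

instance : CompleteSpace (FinitaryFun R N) := by
  refine Metric.complete_of_cauchySeq_tendsto fun v hv => ?_
  choose! K hK using Metric.cauchySeq_iff'.1 hv
  have hconst {t r : ℝ} (ht : 0 < t) (hr : t ≤ r) {n : ℕ} (hn : K t ≤ n) :
      (v n).1 r = (v (K t)).1 r :=
    eq_of_dist_lt ((hK t ht n hn).trans_le hr)
  -- At each `r > 0` the sequence is eventually constant, from index `K r` on.
  let l : ℝ → N := fun r => (v (K r)).1 r
  have hl {t r : ℝ} (ht : 0 < t) (hr : t ≤ r) : l r = (v (K t)).1 r :=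
    (hconst (ht.trans_le hr) le_rfl (le_max_right (K t) (K r))).symm.trans
      (hconst ht hr (le_max_left _ _))
  refine ⟨⟨l, fun r hr => (v (K r)).2.1 r hr, fun t ht => ?_⟩, ?_⟩
  · refine ((v (K t)).2.2 t ht).subset fun r hr => ⟨hr.1, ?_⟩
    rw [← hl ht hr.1]
    exact hr.2
  · refine Metric.tendsto_atTop.2 fun ε hε => ⟨K (ε / 2), fun n hn => ?_⟩
    refine lt_of_le_of_lt ((dist_le_iff (half_pos hε).le).2 fun r hr => ?_) (half_lt_self hε)
    exact (hconst (half_pos hε) hr.le hn).trans (hl (half_pos hε) hr.le).symm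

/-- Functions of finite support are countably many, and truncating below `ε / 2` approximates any
function by one of them. -/
theorem separableSpace [Countable N] (hR : R.Countable) :
    TopologicalSpace.SeparableSpace (FinitaryFun R N) := by
  classical
  refine ⟨{f | (Function.support f.1).Finite}, ?_, ?_⟩
  · have := hR.to_subtype
    have hsupp (f : FinitaryFun R N) (r : ℝ) (hr : r ∉ R) : f.1 r = 0 := by
      by_contra h
      exact hr (f.2.1 r h).1
    let e : {f : FinitaryFun R N | (Function.support f.1).Finite} → (R →₀ N) := fun f =>
      Finsupp.ofSupportFinite (fun r => f.1.1 r) (f.2.preimage Subtype.val_injective.injOn)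
    have he : Function.Injective e := fun f g h => by
      refine Subtype.ext (Subtype.ext (funext fun r => ?_))
      by_cases hr : r ∈ R
      · exact DFunLike.congr_fun h ⟨r, hr⟩
      · rw [hsupp _ r hr, hsupp _ r hr]
    exact he.countable.to_set
  · refine Metric.dense_iff.2 fun f ε hε => ?_
    have ht := half_pos hε
    have hsub : Function.support (fun r => if ε / 2 ≤ r then f.1 r else 0) ⊆
        {r | ε / 2 ≤ r ∧ f.1 r ≠ 0} := fun r hr => by simpa using hr
    have hfin := (f.2.2 _ ht).subset hsub
    refine ⟨⟨fun r => if ε / 2 ≤ r then f.1 r else 0, fun r hr => f.2.1 r (hsub hr).2,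
      fun t _ => hfin.subset fun r hr => hr.2⟩, ?_, hfin⟩
    refine Metric.mem_ball.2 (lt_of_le_of_lt ((dist_le_iff ht.le).2 fun r hr => ?_)
      (half_lt_self hε))
    exact if_pos hr.le

theorem exists_dist_eq [Infinite N] (F : Finset (FinitaryFun R N)) (f : FinitaryFun R N) {r : ℝ}
    (hr : r ∈ R) (hpos : 0 < r) :
    ∃ z, dist z f = r ∧ ∀ g ∈ F, dist g f ≤ r → dist z g = r := by
  classical
  -- The value `a` is new at `r`, so a function equal to `f` above `r` and to `a` at `r` lies at
  -- distance exactly `r` from each listed point within `r` of `f`.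
  obtain ⟨a, ha⟩ := Infinite.exists_notMem_finset ((insert f F).image fun g => g.1 r)
  let h : ℝ → N := fun s => if r < s then f.1 s else if s = r then a else 0
  have hsub (s : ℝ) (hs : h s ≠ 0) : s = r ∨ r < s ∧ f.1 s ≠ 0 := by
    simp only [h] at hs
    split_ifs at hs with h1 h2
    · exact Or.inr ⟨h1, hs⟩
    · exact Or.inl h2
    · exact absurd rfl hs
  let z : FinitaryFun R N := ⟨h, fun s hs => by
    rcases hsub s hs with rfl | hs
    · exact ⟨hr, hpos⟩
    · exact f.2.1 s hs.2, fun t _ => by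
    refine ((finite_singleton r).union (f.2.2 r hpos)).subset fun s hs => ?_
    exact (hsub s hs.2).imp id fun hs => ⟨hs.1.le, hs.2⟩⟩
  have hz (g) (hg : g ∈ insert f F) (hgf : dist g f ≤ r) : dist z g = r := by
    refine dist_of_isGreatest ⟨fun heq => ha ?_, fun s hs => ?_⟩
    · refine Finset.mem_image.2 ⟨g, hg, heq.symm.trans ?_⟩
      simp [z, h]
    · by_contra! hlt
      refine hs ?_
      rw [(dist_le_iff hpos.le).1 hgf s hlt]
      exact if_pos hlt
  exact ⟨z, hz f (Finset.mem_insert_self _ _) (by simpa using hpos.le),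
    fun g hg => hz g (Finset.mem_insert_of_mem hg)⟩

end FinitaryFun

/-! ### From one-point extensions to injectivity -/

/-- A one-point extension property implies injectivity for finite `R`-ultrametric spaces. -/
theorem isMetricInjective_of_exists_dist_eq {R : Set ℝ} {X : Type u} [MetricSpace X]
    [IsUltrametricDist X] [Nonempty X]
    (hX : ∀ (F : Finset X) (x : X), ∀ r ∈ R, 0 < r →
      ∃ z, dist z x = r ∧ ∀ y ∈ F, dist y x ≤ r → dist z y = r) :
    IsMetricInjective (FiniteRUltrametric R) X := by
  classical
  intro A B _ _ hA hB φ ψ hφ hψ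
  have := hA.1
  have := hB.1
  have := hB.2.ultrametric
  have := Fintype.ofFinite A
  have := Fintype.ofFinite B
  have key (T : Finset B) : ∃ g : B → X, (∀ a, g (φ a) = ψ a) ∧
      ∀ b ∈ Finset.univ.image φ ∪ T, ∀ c ∈ Finset.univ.image φ ∪ T,
        dist (g b) (g c) = dist b c := by
    induction T using Finset.induction_on with
    | empty =>
      have hext (a : A) : Function.extend φ ψ (fun _ => Classical.arbitrary X) (φ a) = ψ a :=
        hφ.injective.extend_apply _ _ a
      refine ⟨_, hext, fun b hb c hc => ?_⟩
      simp only [Finset.union_empty, Finset.mem_image, Finset.mem_univ, true_and] at hb hc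
      obtain ⟨a, rfl⟩ := hb
      obtain ⟨a', rfl⟩ := hc
      rw [hext, hext, hψ.dist_eq, hφ.dist_eq]
    | insert b T _ ih =>
      obtain ⟨g, hgφ, hg⟩ := ih
      rw [Finset.union_insert]
      set S := Finset.univ.image φ ∪ T with hS
      by_cases hbS : b ∈ S
      · rw [Finset.insert_eq_of_mem hbS]
        exact ⟨g, hgφ, hg⟩
      obtain ⟨z, hz⟩ : ∃ z : X, ∀ s ∈ S, dist z (g s) = dist b s := by
        rcases S.eq_empty_or_nonempty with hSe | hSne
        · exact ⟨Classical.arbitrary X, by simp [hSe]⟩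
        -- Only a point `c` of `S` nearest to `b` matters: ties with `c` are handled by `hX`, and
        -- distances to farther points are forced by the isosceles property.
        obtain ⟨c, hc, hmin⟩ := S.exists_min_image (fun s => dist b s) hSne
        have hpos : 0 < dist b c := dist_pos.2 fun (h : b = c) => hbS (h ▸ hc)
        obtain ⟨z, hzc, hz⟩ := hX (S.image g) (g c) _ (hB.2.dist_mem b c) hpos
        refine ⟨z, fun s hs => ?_⟩
        rcases (hmin s hs).eq_or_lt with heq | hlt
        · rw [← heq]
          refine hz _ (Finset.mem_image_of_mem g hs) ?_
          rw [hg s hs c hc]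
          refine (dist_triangle_max s b c).trans (max_le ?_ le_rfl)
          rw [dist_comm s b, heq]
        · have h1 : dist c s = dist b s := by
            rw [IsUltrametricDist.dist_eq_max_of_dist_ne_dist c b s
              (by rw [dist_comm c b]; exact hlt.ne), dist_comm c b, max_eq_right hlt.le]
          have h2 : dist (g c) (g s) = dist b s := (hg c hc s hs).trans h1
          rw [IsUltrametricDist.dist_eq_max_of_dist_ne_dist z (g c) (g s)
            (by rw [hzc, h2]; exact hlt.ne), hzc, h2, max_eq_right hlt.le]
      refine ⟨Function.update g b z, fun a => ?_, ?_⟩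
      · rw [Function.update_of_ne, hgφ]
        rintro rfl
        exact hbS (Finset.mem_union_left _ (Finset.mem_image_of_mem φ (Finset.mem_univ a)))
      · have hupd (s) (hs : s ∈ S) : Function.update g b z s = g s :=
          Function.update_of_ne (ne_of_mem_of_not_mem hs hbS) _ _
        simp only [Finset.mem_insert]
        rintro s (rfl | hs) t (rfl | ht)
        · simp
        · rw [Function.update_self, hupd t ht, hz t ht]
        · rw [Function.update_self, hupd s hs, dist_comm, hz s hs, dist_comm]
        · rw [hupd s hs, hupd t ht, hg s hs t ht]
  obtain ⟨g, hgφ, hg⟩ := key Finset.univ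
  exact ⟨g, Isometry.of_dist_eq fun b c => hg b (by simp) c (by simp), funext hgφ⟩

theorem FinitaryFun.isUrysohnUltrametric {R : Set ℝ} (h0 : (0 : ℝ) ∈ R) (hR : R.Countable)
    (N : Type u) [Zero N] [Countable N] [Infinite N] :
    IsUrysohnUltrametric R (FinitaryFun R N) where
  separable := separableSpace hR
  complete := inferInstance
  rUltrametric := ⟨inferInstance, dist_mem h0⟩
  injective := isMetricInjective_of_exists_dist_eq fun F f _ hr hpos => exists_dist_eq F f hr hpos

/-! ### Equilateral sets and noncompactness -/

/-- The set `{0, …, n - 1}` with all distances between distinct points equal to `r`. -/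
def Equilateral (n : ℕ) (_ : {r : ℝ // 0 < r}) : Type := Fin n

namespace Equilateral

variable {n : ℕ} {r : {r : ℝ // 0 < r}}

instance : DecidableEq (Equilateral n r) := inferInstanceAs (DecidableEq (Fin n))

instance : Fintype (Equilateral n r) := inferInstanceAs (Fintype (Fin n))

instance : MetricSpace (Equilateral n r) where
  dist i j := if i = j then 0 else r
  dist_self _ := if_pos rfl
  dist_comm i j := by simp only [eq_comm]
  dist_triangle i j k := by
    have := r.2
    split_ifs <;> simp_all [this.le]
  eq_of_dist_eq_zero {i j} h := by
    by_contra hij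
    exact r.2.ne' ((if_neg hij).symm.trans h)

theorem dist_of_ne {i j : Equilateral n r} (h : i ≠ j) : dist i j = r := if_neg h

theorem finiteRUltrametric {R : Set ℝ} (h0 : (0 : ℝ) ∈ R) (hr : r.1 ∈ R) :
    FiniteRUltrametric R (Equilateral n r) := by
  refine ⟨inferInstance, ⟨⟨fun i j k => ?_⟩, fun i j => ?_⟩⟩
  · by_cases hik : i = k
    · subst hik
      rw [dist_self]
      exact le_max_of_le_left dist_nonneg
    · rw [dist_of_ne hik]
      by_cases hij : i = j
      · subst hij
        rw [dist_of_ne hik]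
        exact le_max_right _ _
      · rw [dist_of_ne hij]
        exact le_max_left _ _
  · by_cases hij : i = j
    · subst hij
      rwa [dist_self]
    · rwa [dist_of_ne hij]

end Equilateral

namespace IsUrysohnUltrametric

variable {R : Set ℝ} {X : Type u} [MetricSpace X]

theorem exists_equilateral (h0 : (0 : ℝ) ∈ R) (hX : IsUrysohnUltrametric R X) (x : X) (n : ℕ)
    (r : {r : ℝ // 0 < r}) (hr : r.1 ∈ R) :
    ∃ θ : Equilateral (n + 1) r → X, Isometry θ ∧ x ∈ range θ := by
  obtain ⟨θ, hθ, h⟩ := hX.injective (Equilateral 1 r) (Equilateral (n + 1) r)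
    (Equilateral.finiteRUltrametric h0 hr) (Equilateral.finiteRUltrametric h0 hr)
    (fun _ => (0 : Fin (n + 1))) (fun _ => x)
    (@isometry_subsingleton _ _ _ _ _ (inferInstanceAs (Subsingleton (Fin 1))))
    (@isometry_subsingleton _ _ _ _ _ (inferInstanceAs (Subsingleton (Fin 1))))
  exact ⟨θ, hθ, _, congrFun h (0 : Fin 1)⟩

theorem nonempty (h0 : (0 : ℝ) ∈ R) (hX : IsUrysohnUltrametric R X) : Nonempty X := by
  have hfin (A : Type) [MetricSpace A] [Finite A] [Subsingleton A] : FiniteRUltrametric R A :=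
    ⟨inferInstance, ⟨⟨fun x y z => by simp [Subsingleton.elim x z]⟩,
      fun x y => by rwa [Subsingleton.elim x y, dist_self]⟩⟩
  -- Extending the empty map to a one-point space produces a point.
  obtain ⟨θ, -, -⟩ := hX.injective Empty Unit (hfin _) (hfin _) Empty.elim Empty.elim
    isometry_subsingleton isometry_subsingleton
  exact ⟨θ ()⟩

theorem not_isCompact (h0 : (0 : ℝ) ∈ R) (hchar : IsCharacteristic R)
    (hRnn : ∀ r ∈ R, 0 ≤ r) (hX : IsUrysohnUltrametric R X) {U : Set X} (hU : IsOpen U)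
    (hne : U.Nonempty) : ¬ IsCompact U := by
  intro hc
  have := hX.rUltrametric.ultrametric
  obtain ⟨x, hx⟩ := hne
  obtain ⟨ε, hε, hball⟩ := Metric.isOpen_iff.1 hU x hx
  obtain ⟨r, ⟨hrR, hr0⟩, hrε⟩ := hchar (ε / 2) (half_pos hε)
  have hr : 0 < r := lt_of_le_of_ne (hRnn r hrR) (Ne.symm hr0)
  obtain ⟨t, htfin, ht⟩ := Metric.totallyBounded_iff.1 hc.totallyBounded r hr
  have := htfin.to_subtype
  have := Fintype.ofFinite t
  -- One more vertex than there are covering balls: two share a ball of radius `r`, so the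
  -- ultrametric inequality puts them closer than `r`.
  obtain ⟨θ, hθ, j, rfl⟩ := hX.exists_equilateral h0 x (Fintype.card t) ⟨r, hr⟩ hrR
  have hθU (i) : ∃ y : t, dist (θ i) y < r := by
    have : θ i ∈ U := hball <| by
      rw [Metric.mem_ball, hθ.dist_eq]
      by_cases hij : i = j
      · rwa [hij, dist_self]
      · rw [Equilateral.dist_of_ne hij]
        exact hrε.trans_lt (half_lt_self hε)
    obtain ⟨y, hy, hd⟩ := mem_iUnion₂.1 (ht this)
    exact ⟨⟨y, hy⟩, hd⟩
  choose p hp using hθU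
  obtain ⟨i, k, hik, hpik⟩ := Fintype.exists_ne_map_eq_of_card_lt p <| by
    rw [show Fintype.card (Equilateral (Fintype.card t + 1) ⟨r, hr⟩) = Fintype.card t + 1 from
      Fintype.card_fin _]
    exact Nat.lt_succ_self _
  refine lt_irrefl r ?_
  calc r = dist (θ i) (θ k) := by rw [hθ.dist_eq, Equilateral.dist_of_ne hik]
    _ ≤ max (dist (θ i) (p i)) (dist (p i : X) (θ k)) := dist_triangle_max _ _ _
    _ < r := max_lt (hp i) (by rw [hpik, dist_comm]; exact hp k)

theorem nonempty_homeomorph_irrational (hR : IsRangeSet R) (hchar : IsCharacteristic R)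
    (hX : IsUrysohnUltrametric R X) : Nonempty (X ≃ₜ {x : ℝ // Irrational x}) := by
  have := hX.rUltrametric.ultrametric
  have := hX.separable
  have := hX.complete
  have := UniformSpace.secondCountable_of_separable X
  have := hX.nonempty hR.zero_mem
  obtain ⟨e⟩ := nonempty_homeomorph_nat_nat X
    (fun x V hV => by
      obtain ⟨ε, hε, hball⟩ := Metric.mem_nhds_iff.1 hV
      exact ⟨_, IsUltrametricDist.isClopen_ball x ε, Metric.mem_ball_self hε, hball⟩)
    fun U hU hne => hX.not_isCompact hR.zero_mem hchar hR.nonneg hU.isOpen hne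
  obtain ⟨e'⟩ := nonempty_homeomorph_irrational_nat_nat
  exact ⟨e.trans e'.symm⟩

end IsUrysohnUltrametric

theorem mainTheorem11 (R : Set ℝ) (hR : IsRangeSet R) (hcount : R.Countable)
    (hchar : IsCharacteristic R) :
    (∃ (X : Type u) (_ : MetricSpace X), IsUrysohnUltrametric R X) ∧
      ∀ (X : Type u) [MetricSpace X], IsUrysohnUltrametric R X →
        Nonempty (X ≃ₜ {x : ℝ // Irrational x}) :=
  ⟨⟨FinitaryFun R (ULift.{u} ℕ), inferInstance,
    FinitaryFun.isUrysohnUltrametric hR.zero_mem hcount _⟩,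
    fun _ _ hX => hX.nonempty_homeomorph_irrational hR hchar⟩
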